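/- Let $d\ge 1$, $0\le\gamma<1$ and $1<\delta\le\infty$. Let $\rho:[0,\infty)\to[0,1]$ be non-increasing with $0<\int_{\mathbb R^d}\rho(|x|^d)\,dx<\infty$ and decay exponent $\delta$; that is, if $\delta<\infty$ (soft profile), there are constants $0<c,C<\infty$ such that $c\,x^{-\delta}\le\rho(x)\le C\,x^{-\delta}$ for all $x\ge 1$, and if $\delta=\infty$ (hard profile), $\rho=1_{[0,r_0]}$ for some $r_0>0$. Let $\mathscr G$ be the random graph whose vertices $(x,u)$ form a homogeneous Poisson point process of intensity $\lambda$ on $\mathbb R^d\times(0,1]$ and in which, given the vertices, each pair $(x,u),(y,v)$ is joined by an edge independently with probability $\rho(|y-x|^d(uv)^\gamma)$; write $\mathbb P^{(\lambda)}$ for its law. With $B(0,r)$ the open ball of radius $r$ around the origin, let $$\theta_r(\lambda)=\mathbb P^{(\lambda)}\big(\text{some path of }\mathscr G\text{ joins } B(0,r)\text{ to }B(0,2r)^{\complement}\big),$$ $$\pi_r(\lambda)=\mathbb P^{(\lambda)}\big(\text{some edge of }\mathscr G\text{ joins } B(0,r)\text{ to }B(0,2r)^{\complement}\big),$$ and $\widehat\lambda_c=\sup\{\lambda\ge0:\lim_{r\to\infty}\theta_r(\lambda)=0\}$.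 If $\delta=2$ or $\gamma=\tfrac12$, then for every $\lambda>0$ we have $\pi_R(\lambda)\asymp 1$, i.e. there are constants $C,R_0>1$ (which may depend on $d,\gamma,\rho,\lambda$) such that $C^{-1}\le\pi_R(\lambda)\le C$ for all $R\ge R_0$. Consequently $\widehat\lambda_c=0$, that is, there is no quantitatively subcritical phase $0<\lambda<\widehat\lambda_c$. -/

import Mathlib

open MeasureTheory ProbabilityTheory Filter Topology
open scoped NNReal ENNReal

noncomputable section

namespace GIRG

/-! ### Profile functions -/

/-- A profile function: a non-increasing function `ρ : [0, ∞) → [0, 1]` such that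
`0 < ∫ ρ(|x|^d) dx < ∞`.  Only the values of `ρ` on `[0, ∞)` matter. -/
structure IsProfile (d : ℕ) (ρ : ℝ → ℝ) : Prop where
  antitone : AntitoneOn ρ (Set.Ici 0)
  mem_Icc : ∀ x, 0 ≤ x → ρ x ∈ Set.Icc (0 : ℝ) 1
  integrable : Integrable (fun x : EuclideanSpace ℝ (Fin d) => ρ (‖x‖ ^ d)) volume
  integral_pos : 0 < ∫ x : EuclideanSpace ℝ (Fin d), ρ (‖x‖ ^ d)

/-- The hard profile `ρ = 1_{[0, r₀]}` for some `r₀ > 0`. -/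
def IsHard (ρ : ℝ → ℝ) : Prop :=
  ∃ r₀ : ℝ, 0 < r₀ ∧ ∀ x, 0 ≤ x → ρ x = if x ≤ r₀ then 1 else 0

/-- A soft profile with decay exponent `δ`: `c x^{-δ} ≤ ρ(x) ≤ C x^{-δ}` for all `x ≥ 1`. -/
def IsSoft (ρ : ℝ → ℝ) (δ : ℝ) : Prop :=
  ∃ c C : ℝ, 0 < c ∧ 0 < C ∧ ∀ x, 1 ≤ x → c * x ^ (-δ) ≤ ρ x ∧ ρ x ≤ C * x ^ (-δ)

/-- The profile `ρ` has decay exponent `δ`, where `δ = ∞` stands for the hard model. -/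
def HasDecayExponent (ρ : ℝ → ℝ) (δ : ℝ≥0∞) : Prop :=
  (δ = ⊤ ∧ IsHard ρ) ∨ (δ ≠ ⊤ ∧ IsSoft ρ δ.toReal)

/-! ### The Poisson point process and the random graph

The space `ℝ^d` is tiled by the unit cubes `∏ᵢ (zᵢ, zᵢ + 1]`, `z ∈ ℤ^d`.  Independently over the
cubes, the cube of `z` contains a Poisson(`λ`) number of points, which are independent and uniform
in the cube and carry independent marks, uniform in `(0, 1]`.  The resulting point set is the
homogeneous Poisson point process of intensity `λ` on `ℝ^d × (0, 1]`.  Each unordered pair of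
points carries a further independent uniform variable on `(0, 1]`, which decides whether the
edge between the two points is present. -/

/-- The cubes, named by their corners. -/
abbrev Cell (d : ℕ) : Type := Fin d → ℤ

/-- The label `(z, k)` stands for the `k`-th point (`k = 0, 1, 2, …`) of the cube of `z`. -/
abbrev Label (d : ℕ) : Type := Cell d × ℕ

/-- The uniform distribution on `(0, 1]`. -/
def unif : Measure ℝ := (volume : Measure ℝ).restrict (Set.Ioc 0 1)

instance : IsProbabilityMeasure unif := ⟨by simp [unif]⟩

/-- The sample space: the number of points in each cube, the positions of the points relative to
the corner of their cube, the marks of the points, and the variables attached to the pairs. -/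
abbrev Sample (d : ℕ) : Type :=
  (Cell d → ℕ) × (Label d × Fin d → ℝ) × (Label d → ℝ) × (Sym2 (Label d) → ℝ)

/-- The probability measure `ℙ^{(λ)}`, under which all coordinates are independent, the numbers of
points are Poisson distributed with mean `λ`, and all other coordinates are uniform on `(0, 1]`. -/
def prob (d : ℕ) (lam : ℝ≥0) : Measure (Sample d) :=
  (Measure.infinitePi fun _ : Cell d => poissonMeasure lam).prod
    ((Measure.infinitePi fun _ : Label d × Fin d => unif).prod
      ((Measure.infinitePi fun _ : Label d => unif).prod
        (Measure.infinitePi fun _ : Sym2 (Label d) => unif)))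

instance (d : ℕ) (lam : ℝ≥0) : IsProbabilityMeasure (prob d lam) := by
  unfold prob; infer_instance

variable {d : ℕ}

/-- The label belongs to an actual vertex, i.e. its cube contains sufficiently many points. -/
def IsVertex (ω : Sample d) (a : Label d) : Prop := a.2 < ω.1 a.1

/-- The position in `ℝ^d` of the vertex with label `a`. -/
def pos (ω : Sample d) (a : Label d) : EuclideanSpace ℝ (Fin d) :=
  WithLp.toLp 2 fun i => (a.1 i : ℝ) + ω.2.1 (a, i)

/-- The mark in `(0, 1]` of the vertex with label `a`. -/
def mark (ω : Sample d) (a : Label d) : ℝ := ω.2.2.1 a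

/-- The geometric inhomogeneous random graph: given the vertices, the pair `(x, u)`, `(y, v)` is
an edge with probability `ρ(|y - x|^d (u v)^γ)`, independently over pairs.
Labels which do not belong to a vertex are isolated. -/
def graph (γ : ℝ) (ρ : ℝ → ℝ) (ω : Sample d) : SimpleGraph (Label d) where
  Adj a b := a ≠ b ∧ IsVertex ω a ∧ IsVertex ω b ∧
    ω.2.2.2 s(a, b) ≤ ρ (‖pos ω b - pos ω a‖ ^ d * (mark ω a * mark ω b) ^ γ)
  symm := ⟨fun a b h => ⟨h.1.symm, h.2.2.1, h.2.1, by
    rw [Sym2.eq_swap, norm_sub_rev, mul_comm (mark ω b)]; exact h.2.2.2⟩⟩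
  loopless := ⟨fun _ h => h.1 rfl⟩

/-- The event `A ⟷ B`: there is a (self-avoiding) path with endpoints in `A` and `B`. -/
def Connected (γ : ℝ) (ρ : ℝ → ℝ) (A B : Set (EuclideanSpace ℝ (Fin d))) : Set (Sample d) :=
  {ω | ∃ a b : Label d, IsVertex ω a ∧ IsVertex ω b ∧ pos ω a ∈ A ∧ pos ω b ∈ B ∧
    ∃ p : (graph γ ρ ω).Walk a b, p.IsPath}

/-- The event that there is a path with at most `k` edges with endpoints in `A` and `B`. -/
def ConnectedWithin (k : ℕ) (γ : ℝ) (ρ : ℝ → ℝ) (A B : Set (EuclideanSpace ℝ (Fin d))) :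
    Set (Sample d) :=
  {ω | ∃ a b : Label d, IsVertex ω a ∧ IsVertex ω b ∧ pos ω a ∈ A ∧ pos ω b ∈ B ∧
    ∃ p : (graph γ ρ ω).Walk a b, p.IsPath ∧ p.length ≤ k}

/-- The annulus crossing probability `θ_r(λ) = ℙ^{(λ)}(B(0, r) ⟷ B(0, 2r)ᶜ)`. -/
def crossProb (d : ℕ) (γ : ℝ) (ρ : ℝ → ℝ) (lam : ℝ≥0) (r : ℝ) : ℝ :=
  (prob d lam).real (Connected γ ρ (Metric.ball 0 r) (Metric.ball 0 (2 * r))ᶜ)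

/-- The one-edge annulus crossing probability `π_r(λ)`: the probability that `B(0, r)` and
`B(0, 2r)ᶜ` are joined by a path with at most one edge. -/
def oneEdgeCrossProb (d : ℕ) (γ : ℝ) (ρ : ℝ → ℝ) (lam : ℝ≥0) (r : ℝ) : ℝ :=
  (prob d lam).real (ConnectedWithin 1 γ ρ (Metric.ball 0 r) (Metric.ball 0 (2 * r))ᶜ)

/-- The critical parameter `λ̂_c = sup {λ ≥ 0 : lim_{r → ∞} θ_r(λ) = 0}`, as an element of
`[0, ∞]`. -/
def criticalIntensity (d : ℕ) (γ : ℝ) (ρ : ℝ → ℝ) : ℝ≥0∞ :=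
  ⨆ (lam : ℝ≥0) (_ : Tendsto (crossProb d γ ρ lam) atTop (𝓝 0)), (lam : ℝ≥0∞)

/-! ### Asymptotic comparison of functions of the radius -/

/-- `f ≲ g`: there are `C, R₀ > 1` with `f(R) ≤ C g(R)` for all `R ≥ R₀`. -/
def AsympLE (f g : ℝ → ℝ) : Prop :=
  ∃ C R₀ : ℝ, 1 < C ∧ 1 < R₀ ∧ ∀ R, R₀ ≤ R → f R ≤ C * g R

/-- `f ≍ g`: both `f ≲ g` and `g ≲ f`. -/
def AsympEq (f g : ℝ → ℝ) : Prop := AsympLE f g ∧ AsympLE g f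

end GIRG

end

namespace GIRG

/-! At scale `R` there are about `N ≈ R^d` cubes inside the ball and as many beyond `2R`, hence `N²`
candidate edges of length at most a constant times `R` (`exists_cells`). In either critical case
each candidate occurs with probability of order `N⁻²`: for `δ = 2` because `ρ(LN) ≳ N⁻²`; for `γ =
1/2` because two marks of order `1/N` keep the argument of `ρ` bounded.

Instead of a second moment argument, each candidate event also demands that no competing variable is
small. This costs only a factor `1/2` and makes the `N²` events disjoint, so their probabilities add
up to a constant (`le_oneEdgeCrossProb`). As `θ_R ≥ π_R`, no `λ > 0` is quantitatively subcritical.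
-/

/-! ### Geometry of the cubes -/

theorem norm_le_of_abs_le {d : ℕ} (x : EuclideanSpace ℝ (Fin d)) {M : ℝ} (hM : 0 ≤ M)
    (h : ∀ i, |x i| ≤ M) : ‖x‖ ≤ d * M := by
  refine abs_le_of_sq_le_sq' ?_ (by positivity) |>.2
  rw [EuclideanSpace.norm_sq_eq]
  calc ∑ i, ‖x i‖ ^ 2 ≤ ∑ _i : Fin d, M ^ 2 :=
        Finset.sum_le_sum fun i _ => pow_le_pow_left₀ (norm_nonneg _) (h i) 2
    _ = d * M ^ 2 := by simp
    _ ≤ (d * M) ^ 2 := by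
        have : (d : ℝ) ≤ d ^ 2 := by exact_mod_cast Nat.le_self_pow two_ne_zero d
        rw [mul_pow]; gcongr

/-- The half-open unit cube with corner `z`. -/
def cube {d : ℕ} (z : Cell d) : Set (EuclideanSpace ℝ (Fin d)) :=
  {x | ∀ i, x i ∈ Set.Ioc (z i : ℝ) (z i + 1)}

theorem exists_cells (d : ℕ) (hd : 1 ≤ d) : ∃ L R₀ : ℝ, 1 ≤ L ∧ 1 < R₀ ∧ ∀ R, R₀ ≤ R →
    ∃ (N : ℕ) (A B : Finset (Cell d)), 1 ≤ N ∧ Disjoint A B ∧ A.card = N ∧ B.card = N ∧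
      ∀ z ∈ A, ∀ w ∈ B, ∀ x ∈ cube z, ∀ y ∈ cube w,
        x ∈ Metric.ball 0 R ∧ y ∈ (Metric.ball 0 (2 * R))ᶜ ∧ ‖y - x‖ ^ d ≤ L * N := by
  have hd1 : (1 : ℝ) ≤ d := by exact_mod_cast hd
  have hd0 : (0 : ℝ) < d := by linarith
  -- Distances will be at most `5dR`, and `R ≥ 4d` makes the floor `m` of `R/(2d)` satisfy `R ≤
  -- 4dm`; together they give `20d²m`.
  refine ⟨(20 * d ^ 2 : ℝ) ^ d, 4 * d, one_le_pow₀ (by nlinarith), by linarith, fun R hR => ?_⟩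
  have hR0 : 0 < R := by linarith
  obtain ⟨m, hm⟩ : ∃ m : ℕ, m = ⌊R / (2 * d)⌋₊ := ⟨_, rfl⟩
  obtain ⟨K, hK⟩ : ∃ K : ℕ, K = ⌈R⌉₊ := ⟨_, rfl⟩
  have hm1 : 2 * d * m ≤ R := by
    have := Nat.floor_le (a := R / (2 * d)) (by positivity)
    rw [← hm, le_div_iff₀ (by positivity)] at this; linarith
  have hm2 : R ≤ 4 * d * m := by
    have := Nat.lt_floor_add_one (R / (2 * d))
    rw [← hm, div_lt_iff₀ (by positivity)] at this; nlinarith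
  have hK1 : R ≤ K := hK ▸ Nat.le_ceil R
  have hK2 : (K : ℝ) ≤ 2 * R := by
    have := Nat.ceil_lt_add_one hR0.le
    rw [← hK] at this; linarith
  have hm0 : 0 < (m : ℝ) := by
    by_contra h
    have : (m : ℝ) = 0 := le_antisymm (not_lt.1 h) (by positivity)
    rw [this] at hm2; linarith
  have hmR : (m : ℝ) ≤ R := by nlinarith
  have hmK : m ≤ K := by exact_mod_cast hmR.trans hK1
  -- Two blocks of side `m`: one at the origin, of norm at most `dm ≤ R/2`, and its translate by `2K
  -- ≥ 2R` in every coordinate.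
  refine ⟨m ^ d, Fintype.piFinset fun _ => Finset.Ico 0 (m : ℤ),
    Fintype.piFinset fun _ => Finset.Ico (2 * K : ℤ) (2 * K + m), ?_, ?_, ?_, ?_, ?_⟩
  · exact Nat.one_le_pow _ _ (by exact_mod_cast hm0)
  · rw [Finset.disjoint_left]
    intro z hz hw
    have h1 := Fintype.mem_piFinset.1 hz ⟨0, hd⟩
    have h2 := Fintype.mem_piFinset.1 hw ⟨0, hd⟩
    rw [Finset.mem_Ico] at h1 h2
    omega
  · simp
  · simp
  intro z hz w hw x hx y hy
  have hx' : ∀ i, 0 < x i ∧ x i ≤ m := fun i => by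
    have h1 := Fintype.mem_piFinset.1 hz i
    rw [Finset.mem_Ico] at h1
    have h2 : (0 : ℝ) ≤ z i := by exact_mod_cast h1.1
    have h3 : (z i : ℝ) + 1 ≤ m := by exact_mod_cast h1.2
    exact ⟨h2.trans_lt (hx i).1, (hx i).2.trans h3⟩
  have hy' : ∀ i, 2 * K < y i ∧ y i ≤ 2 * K + m := fun i => by
    have h1 := Fintype.mem_piFinset.1 hw i
    rw [Finset.mem_Ico] at h1
    have h2 : (2 * K : ℝ) ≤ w i := by exact_mod_cast h1.1
    have h3 : (w i : ℝ) + 1 ≤ 2 * K + m := by exact_mod_cast h1.2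
    exact ⟨h2.trans_lt (hy i).1, (hy i).2.trans h3⟩
  refine ⟨?_, ?_, ?_⟩
  · rw [mem_ball_zero_iff]
    have := norm_le_of_abs_le x hm0.le fun i => by
      rw [abs_of_pos (hx' i).1]; exact (hx' i).2
    nlinarith
  · rw [Set.mem_compl_iff, mem_ball_zero_iff, not_lt]
    have h1 := PiLp.norm_apply_le y ⟨0, hd⟩
    have h2 := (hy' ⟨0, hd⟩).1
    have h3 := Real.le_norm_self (y ⟨0, hd⟩)
    linarith
  · have h1 : ‖y - x‖ ≤ d * (5 * R) := norm_le_of_abs_le _ (by positivity) fun i => by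
      rw [PiLp.sub_apply, abs_le]
      have := hx' i
      have := hy' i
      constructor <;> linarith
    push_cast
    rw [← mul_pow]
    exact pow_le_pow_left₀ (norm_nonneg _) (h1.trans (by nlinarith)) d

/-! ### Exact patterns of small uniform variables -/

/-- The configurations with values in `(0, 1]` on the finite set `S` whose values are at most `s`
exactly on the subset `T`. -/
def lowSet {ι : Type*} [DecidableEq ι] (S T : Finset ι) (s : ℝ) : Set (ι → ℝ) :=
  Set.pi S fun i => if i ∈ T then Set.Ioc 0 s else Set.Ioc s 1

theorem measurableSet_lowSet {ι : Type*} [DecidableEq ι] (S T : Finset ι) (s : ℝ) :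
    MeasurableSet (lowSet S T s) := by
  refine MeasurableSet.pi S.countable_toSet fun i _ => ?_
  split_ifs <;> exact measurableSet_Ioc

theorem unif_real_Ioc {a b : ℝ} (ha : 0 ≤ a) (hab : a ≤ b) (hb : b ≤ 1) :
    unif.real (Set.Ioc a b) = b - a := by
  rw [unif, measureReal_restrict_apply measurableSet_Ioc,
    Set.inter_eq_left.2 (Set.Ioc_subset_Ioc ha hb), Real.volume_real_Ioc_of_le hab]

theorem infinitePi_real_pi {ι X : Type*} [MeasurableSpace X] (μ : Measure X)
    [IsProbabilityMeasure μ] (S : Finset ι) {t : ι → Set X} (ht : ∀ i ∈ S, MeasurableSet (t i)) :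
    (Measure.infinitePi fun _ : ι => μ).real (Set.pi S t) = ∏ i ∈ S, μ.real (t i) := by
  rw [measureReal_def, Measure.infinitePi_pi _ ht, ENNReal.toReal_prod]
  rfl

theorem infinitePi_unif_real_lowSet {ι : Type*} [DecidableEq ι] {S T : Finset ι} (hTS : T ⊆ S)
    {s : ℝ} (hs0 : 0 ≤ s) (hs1 : s ≤ 1) :
    (Measure.infinitePi fun _ : ι => unif).real (lowSet S T s) =
      s ^ T.card * (1 - s) ^ (S \ T).card := by
  rw [lowSet, infinitePi_real_pi]
  · rw [← Finset.prod_sdiff hTS, mul_comm]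
    congr 1
    · rw [← Finset.prod_const]
      refine Finset.prod_congr rfl fun i hi => ?_
      rw [if_pos hi, unif_real_Ioc le_rfl hs0 hs1, sub_zero]
    · rw [← Finset.prod_const]
      refine Finset.prod_congr rfl fun i hi => ?_
      rw [if_neg (Finset.mem_sdiff.1 hi).2, unif_real_Ioc hs0 hs1 le_rfl]
  · intro i _
    split_ifs <;> exact measurableSet_Ioc

/-- By Bernoulli's inequality, keeping all other variables above `s` costs at most a factor `1/2`
while their expected number below `s` is at most `1/2`. -/
theorem le_infinitePi_unif_real_lowSet {ι : Type*} [DecidableEq ι] {S T : Finset ι} (hTS : T ⊆ S)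
    {s : ℝ} (hs0 : 0 ≤ s) (hs1 : s ≤ 1) (hS : S.card * s ≤ 1 / 2) :
    s ^ T.card * (1 / 2) ≤ (Measure.infinitePi fun _ : ι => unif).real (lowSet S T s) := by
  rw [infinitePi_unif_real_lowSet hTS hs0 hs1]
  refine mul_le_mul_of_nonneg_left ?_ (by positivity)
  have h1 := one_add_mul_le_pow (a := -s) (by linarith) (S \ T).card
  have h2 : (((S \ T).card : ℕ) : ℝ) ≤ S.card := by
    exact_mod_cast Finset.card_le_card Finset.sdiff_subset
  have h3 := mul_le_mul_of_nonneg_right h2 hs0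
  rw [← sub_eq_add_neg] at h1
  linarith

theorem infinitePi_unif_real_lowSet_self {ι : Type*} [DecidableEq ι] (T : Finset ι)
    {s : ℝ} (hs0 : 0 ≤ s) (hs1 : s ≤ 1) :
    (Measure.infinitePi fun _ : ι => unif).real (lowSet T T s) = s ^ T.card := by
  rw [infinitePi_unif_real_lowSet subset_rfl hs0 hs1]; simp

/-- A coordinate in `T` but not in `T'` would have to be both at most `s` and above `s`. -/
theorem disjoint_lowSet {ι : Type*} [DecidableEq ι] {S T T' : Finset ι} (hT : T ⊆ S)
    (h : ¬ T ⊆ T') (s : ℝ) : Disjoint (lowSet S T s) (lowSet S T' s) := by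
  obtain ⟨i, hi, hi'⟩ := Finset.not_subset.1 h
  rw [Set.disjoint_left]
  intro x hx hx'
  have h1 := hx i (hT hi)
  have h2 := hx' i (hT hi)
  simp only [if_pos hi] at h1
  simp only [if_neg hi'] at h2
  exact absurd h1.2 (not_le.2 h2.1)

/-! ### Disjoint events forcing one long edge -/

/-- The labels of the first points of two cubes. -/
def endpoints {d : ℕ} (a : Cell d × Cell d) : Finset (Label d) := {(a.1, 0), (a.2, 0)}

/-- The pair formed by the first points of two cubes. -/
def link {d : ℕ} (a : Cell d × Cell d) : Sym2 (Label d) := s((a.1, 0), (a.2, 0))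

/-- Two cubes are occupied, and the marks and the pair variables lie in given sets. -/
def pairEvent {d : ℕ} (a : Cell d × Cell d) (M : Set (Label d → ℝ))
    (W : Set (Sym2 (Label d) → ℝ)) : Set (Sample d) :=
  (Set.pi ({a.1, a.2} : Finset (Cell d)) fun _ => Set.Ioi 0) ×ˢ
    -- With threshold `1` this full-probability condition only discards offsets outside `(0, 1]`, so
    -- that points really lie in their cubes.
    (lowSet (endpoints a ×ˢ Finset.univ) (endpoints a ×ˢ Finset.univ) 1 ×ˢ (M ×ˢ W))

theorem measurableSet_pairEvent {d : ℕ} (a : Cell d × Cell d) {M : Set (Label d → ℝ)}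
    {W : Set (Sym2 (Label d) → ℝ)} (hM : MeasurableSet M) (hW : MeasurableSet W) :
    MeasurableSet (pairEvent a M W) :=
  (MeasurableSet.pi (Finset.countable_toSet _) fun _ _ => measurableSet_Ioi).prod
    ((measurableSet_lowSet _ _ _).prod (hM.prod hW))

theorem prob_real_pairEvent {d : ℕ} (lam : ℝ≥0) {a : Cell d × Cell d} (ha : a.1 ≠ a.2)
    (M : Set (Label d → ℝ)) (W : Set (Sym2 (Label d) → ℝ)) :
    (prob d lam).real (pairEvent a M W) = (poissonMeasure lam).real (Set.Ioi 0) ^ 2 *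
      ((Measure.infinitePi fun _ : Label d => unif).real M *
        (Measure.infinitePi fun _ : Sym2 (Label d) => unif).real W) := by
  rw [prob, pairEvent, measureReal_prod_prod, measureReal_prod_prod, measureReal_prod_prod,
    infinitePi_unif_real_lowSet_self _ zero_le_one le_rfl, one_pow, one_mul,
    infinitePi_real_pi _ _ fun _ _ => measurableSet_Ioi, Finset.prod_const,
    Finset.card_pair ha]

theorem pairEvent_subset_connectedWithin {d : ℕ} {γ : ℝ} {ρ : ℝ → ℝ} {s q : ℝ}
    {a : Cell d × Cell d} (ha : a.1 ≠ a.2) {S₁ : Finset (Label d)} {S₂ : Finset (Sym2 (Label d))}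
    (h₁ : endpoints a ⊆ S₁) (h₂ : link a ∈ S₂) {X Y : Set (EuclideanSpace ℝ (Fin d))}
    (hX : cube a.1 ⊆ X) (hY : cube a.2 ⊆ Y)
    (hq : ∀ x ∈ cube a.1, ∀ y ∈ cube a.2, ∀ u ∈ Set.Ioc 0 s, ∀ v ∈ Set.Ioc 0 s,
      q ≤ ρ (‖y - x‖ ^ d * (u * v) ^ γ)) :
    pairEvent a (lowSet S₁ (endpoints a) s) (lowSet S₂ {link a} q) ⊆
      ConnectedWithin 1 γ ρ X Y := by
  rintro ω ⟨hocc, hpos, hmark, hlink⟩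
  have hm1 : ((a.1, 0) : Label d) ∈ endpoints a := by simp [endpoints]
  have hm2 : ((a.2, 0) : Label d) ∈ endpoints a := by simp [endpoints]
  have hcube : ∀ z, ((z, 0) : Label d) ∈ endpoints a → pos ω (z, 0) ∈ cube z := fun z hz i => by
    have hmem := Finset.mk_mem_product hz (Finset.mem_univ i)
    have h := hpos _ hmem
    simp only [if_pos hmem] at h
    exact ⟨by simpa [pos] using h.1, by simpa [pos] using h.2⟩
  have hmk : ∀ l ∈ endpoints a, mark ω l ∈ Set.Ioc 0 s := fun l hl => by
    have h := hmark l (h₁ hl)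
    simp only [if_pos hl] at h
    exact h
  have hv1 : IsVertex ω (a.1, 0) := hocc a.1 (by simp)
  have hv2 : IsVertex ω (a.2, 0) := hocc a.2 (by simp)
  have hne : ((a.1, 0) : Label d) ≠ (a.2, 0) := fun h => ha (congrArg Prod.fst h)
  have hadj : (graph γ ρ ω).Adj (a.1, 0) (a.2, 0) := by
    refine ⟨hne, hv1, hv2, ?_⟩
    have h := hlink (link a) h₂
    simp only [Finset.mem_singleton, if_true] at h
    exact h.2.trans (hq _ (hcube _ hm1) _ (hcube _ hm2) _ (hmk _ hm1) _ (hmk _ hm2))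
  exact ⟨_, _, hv1, hv2, hX (hcube _ hm1), hY (hcube _ hm2), hadj.toWalk,
    by simp [SimpleGraph.Walk.isPath_def, hne], by simp⟩

/-- The pair events are disjoint, through the marks or through the pair variables, so the
probability of their union is a sum. Leaving this choice open serves both critical cases. -/
theorem le_oneEdgeCrossProb {d : ℕ} {γ : ℝ} {ρ : ℝ → ℝ} {s q R : ℝ} (lam : ℝ≥0)
    {A B : Finset (Cell d)} (hAB : Disjoint A B)
    {S₁ : Cell d × Cell d → Finset (Label d)} {S₂ : Cell d × Cell d → Finset (Sym2 (Label d))}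
    (h₁ : ∀ a ∈ A ×ˢ B, endpoints a ⊆ S₁ a) (h₂ : ∀ a ∈ A ×ˢ B, link a ∈ S₂ a)
    (hX : ∀ z ∈ A, cube z ⊆ Metric.ball 0 R) (hY : ∀ w ∈ B, cube w ⊆ (Metric.ball 0 (2 * R))ᶜ)
    (hq : ∀ z ∈ A, ∀ w ∈ B, ∀ x ∈ cube z, ∀ y ∈ cube w, ∀ u ∈ Set.Ioc 0 s, ∀ v ∈ Set.Ioc 0 s,
      q ≤ ρ (‖y - x‖ ^ d * (u * v) ^ γ))
    (hdisj : ∀ a ∈ A ×ˢ B, ∀ b ∈ A ×ˢ B, a ≠ b →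
      Disjoint (lowSet (S₁ a) (endpoints a) s) (lowSet (S₁ b) (endpoints b) s) ∨
      Disjoint (lowSet (S₂ a) {link a} q) (lowSet (S₂ b) {link b} q))
    {p₁ p₂ : ℝ} (hp₂ : 0 ≤ p₂)
    (hb₁ : ∀ a ∈ A ×ˢ B, p₁ ≤
      (Measure.infinitePi fun _ : Label d => unif).real (lowSet (S₁ a) (endpoints a) s))
    (hb₂ : ∀ a ∈ A ×ˢ B, p₂ ≤
      (Measure.infinitePi fun _ : Sym2 (Label d) => unif).real (lowSet (S₂ a) {link a} q)) :
    (A.card * B.card : ℝ) * ((poissonMeasure lam).real (Set.Ioi 0) ^ 2 * (p₁ * p₂)) ≤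
      oneEdgeCrossProb d γ ρ lam R := by
  have hne : ∀ a ∈ A ×ˢ B, a.1 ≠ a.2 := fun a ha h =>
    Finset.disjoint_left.1 hAB (Finset.mem_product.1 ha).1 (h ▸ (Finset.mem_product.1 ha).2)
  let E : Cell d × Cell d → Set (Sample d) := fun a =>
    pairEvent a (lowSet (S₁ a) (endpoints a) s) (lowSet (S₂ a) {link a} q)
  have hE : (prob d lam).real (⋃ a ∈ A ×ˢ B, E a) = ∑ a ∈ A ×ˢ B, (prob d lam).real (E a) := by
    refine measureReal_biUnion_finset (fun a ha b hb hab => ?_) fun a _ =>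
      measurableSet_pairEvent a (measurableSet_lowSet _ _ _) (measurableSet_lowSet _ _ _)
    rw [Function.onFun, Set.disjoint_left]
    rintro ω ⟨-, -, h1, h2⟩ ⟨-, -, h3, h4⟩
    rcases hdisj a ha b hb hab with h | h
    · exact Set.disjoint_left.1 h h1 h3
    · exact Set.disjoint_left.1 h h2 h4
  have hsub : (⋃ a ∈ A ×ˢ B, E a) ⊆
      ConnectedWithin 1 γ ρ (Metric.ball 0 R) (Metric.ball 0 (2 * R))ᶜ :=
    Set.iUnion₂_subset fun a ha => by
      obtain ⟨hA, hB⟩ := Finset.mem_product.1 ha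
      exact pairEvent_subset_connectedWithin (hne a ha) (h₁ a ha) (h₂ a ha) (hX _ hA) (hY _ hB)
        (hq _ hA _ hB)
  refine le_trans ?_ (measureReal_mono hsub)
  rw [hE, ← Nat.cast_mul, ← Finset.card_product, ← nsmul_eq_mul]
  refine Finset.card_nsmul_le_sum _ _ _ fun a ha => ?_
  rw [prob_real_pairEvent lam (hne a ha)]
  have h1 := hb₁ a ha
  have h2 := hb₂ a ha
  gcongr

/-! ### Lower bounds in the two critical cases -/

theorem poissonMeasure_real_Ioi_pos {lam : ℝ≥0} (hlam : 0 < lam) :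
    0 < (poissonMeasure lam).real (Set.Ioi 0) :=
  (poissonMeasure_real_singleton_pos 1 hlam).trans_le (measureReal_mono (by simp))

theorem card_endpoints {d : ℕ} {a : Cell d × Cell d} (ha : a.1 ≠ a.2) :
    (endpoints a).card = 2 :=
  Finset.card_pair fun h => ha (congrArg Prod.fst h)

theorem exists_pos_le_oneEdgeCrossProb_of_exponent_two {d : ℕ} (hd : 1 ≤ d) {γ : ℝ} (hγ : 0 ≤ γ)
    {ρ : ℝ → ℝ} (hρ : IsProfile d ρ) (hs : IsSoft ρ 2) {lam : ℝ≥0} (hlam : 0 < lam) :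
    ∃ c R₀ : ℝ, 0 < c ∧ 1 < R₀ ∧ ∀ R, R₀ ≤ R → c ≤ oneEdgeCrossProb d γ ρ lam R := by
  obtain ⟨L, R₀, hL, hR₀, hcells⟩ := exists_cells d hd
  obtain ⟨c, C, hc, -, hρc⟩ := hs
  have hp := poissonMeasure_real_Ioi_pos hlam
  let p := (poissonMeasure lam).real (Set.Ioi 0)
  have hL0 : 0 < L := by linarith
  -- With `q = t/N²`, the first bound allows Bernoulli over at most `N²` links, the second gives `q
  -- ≤ c(LN)⁻² ≤ ρ(LN)`.
  obtain ⟨t, ht0, ht2, htc⟩ : ∃ t : ℝ, 0 < t ∧ t ≤ 1 / 2 ∧ t ≤ c / L ^ 2 :=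
    ⟨min (1 / 2) (c / L ^ 2), by positivity, min_le_left _ _, min_le_right _ _⟩
  refine ⟨p ^ 2 * (t * (1 / 2)), R₀, by positivity, hR₀, fun R hR => ?_⟩
  obtain ⟨N, A, B, hN, hAB, hA, hB, hgeo⟩ := hcells R hR
  have hN1 : (1 : ℝ) ≤ N := by exact_mod_cast hN
  have hN0 : (0 : ℝ) < N := by linarith
  have hNN : (1 : ℝ) ≤ N ^ 2 := one_le_pow₀ hN1
  obtain ⟨a₀, ha₀⟩ : A.Nonempty := Finset.card_pos.1 (by omega)
  obtain ⟨b₀, hb₀⟩ : B.Nonempty := Finset.card_pos.1 (by omega)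
  have hqt : t / N ^ 2 ≤ t := div_le_self ht0.le hNN
  have hcard : ((((A ×ˢ B).image link).card : ℕ) : ℝ) ≤ N ^ 2 := by
    have := Finset.card_image_le (s := A ×ˢ B) (f := link)
    rw [Finset.card_product, hA, hB, ← sq] at this
    exact_mod_cast this
  have hcube : ∀ z : Cell d, WithLp.toLp 2 (fun i => (z i : ℝ) + 1) ∈ cube z := fun z i => by simp
  -- Marks are unrestricted (`s = 1`); the unique small pair variable identifies the edge.
  have key := le_oneEdgeCrossProb (γ := γ) (ρ := ρ) (s := 1) (q := t / N ^ 2) (R := R) lam hAB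
    (S₁ := endpoints) (S₂ := fun _ => (A ×ˢ B).image link) (fun _ _ => subset_rfl)
    (fun a ha => Finset.mem_image_of_mem _ ha)
    (fun z hz x hx => (hgeo z hz b₀ hb₀ x hx _ (hcube b₀)).1)
    (fun w hw y hy => (hgeo a₀ ha₀ w hw _ (hcube a₀) y hy).2.1)
    (fun z hz w hw x hx y hy u hu v hv => by
      have hD := (hgeo z hz w hw x hx y hy).2.2
      have huv : (u * v) ^ γ ≤ 1 :=
        Real.rpow_le_one (mul_nonneg hu.1.le hv.1.le) (mul_le_one₀ hu.2 hv.1.le hv.2) hγ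
      have huv0 : 0 ≤ (u * v) ^ γ := Real.rpow_nonneg (mul_nonneg hu.1.le hv.1.le) _
      have h1 : ‖y - x‖ ^ d * (u * v) ^ γ ≤ L * N :=
        (mul_le_of_le_one_right (by positivity) huv).trans hD
      have h2 := hρ.antitone (Set.mem_Ici.2 (by positivity)) (Set.mem_Ici.2 (by positivity)) h1
      have h3 := (hρc (L * N) (one_le_mul_of_one_le_of_one_le hL hN1)).1
      refine le_trans ?_ (h3.trans h2)
      rw [Real.rpow_neg (by positivity), Real.rpow_two, mul_pow, ← div_eq_mul_inv,
        ← div_div]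
      gcongr)
    (fun a ha b hb hab => Or.inr (disjoint_lowSet
      (Finset.singleton_subset_iff.2 (Finset.mem_image_of_mem _ ha)) (fun h => hab ?_) _))
    (p₁ := 1) (p₂ := t / N ^ 2 * (1 / 2)) (by positivity)
    (fun a _ => by rw [infinitePi_unif_real_lowSet_self _ zero_le_one le_rfl, one_pow])
    (fun a ha => by
      refine le_trans (le_of_eq ?_) (le_infinitePi_unif_real_lowSet
        (Finset.singleton_subset_iff.2 (Finset.mem_image_of_mem _ ha)) (by positivity)
        (by linarith) ?_)
      · rw [Finset.card_singleton, pow_one]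
      · refine (mul_le_mul_of_nonneg_right hcard (by positivity)).trans ?_
        rw [mul_div_cancel₀ _ (by positivity)]; exact ht2)
  · refine le_trans (le_of_eq ?_) key
    rw [hA, hB]
    field_simp
    rfl
  · rw [Finset.singleton_subset_iff, Finset.mem_singleton, link, link, Sym2.eq_iff] at h
    simp only [Prod.mk.injEq, and_true] at h
    -- A link is unordered, but a swapped pair would put a cube of `A` in `B`.
    rcases h with h | h
    · exact Prod.ext h.1 h.2
    · exact absurd (Finset.mem_product.1 hb).2 (Finset.disjoint_left.1 hAB
        (h.1 ▸ (Finset.mem_product.1 ha).1))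

theorem exists_pos_le_oneEdgeCrossProb_of_gamma_half {d : ℕ} (hd : 1 ≤ d)
    {ρ : ℝ → ℝ} (hρ : IsProfile d ρ) {r : ℝ} (hr : 0 < r) (hρr : 0 < ρ r) {lam : ℝ≥0}
    (hlam : 0 < lam) :
    ∃ c R₀ : ℝ, 0 < c ∧ 1 < R₀ ∧ ∀ R, R₀ ≤ R → c ≤ oneEdgeCrossProb d (1 / 2) ρ lam R := by
  obtain ⟨L, R₀, hL, hR₀, hcells⟩ := exists_cells d hd
  have hp := poissonMeasure_real_Ioi_pos hlam
  let p := (poissonMeasure lam).real (Set.Ioi 0)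
  have hL0 : 0 < L := by linarith
  -- With `s = t/N`, the first bound allows Bernoulli over at most `2N` marks, the second gives `LN
  -- · (t/N) ≤ r`.
  obtain ⟨t, ht0, ht4, htr⟩ : ∃ t : ℝ, 0 < t ∧ t ≤ 1 / 4 ∧ t ≤ r / L :=
    ⟨min (1 / 4) (r / L), by positivity, min_le_left _ _, min_le_right _ _⟩
  refine ⟨p ^ 2 * (t ^ 2 * (1 / 2) * ρ r), R₀, by positivity, hR₀, fun R hR => ?_⟩
  obtain ⟨N, A, B, hN, hAB, hA, hB, hgeo⟩ := hcells R hR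
  have hN1 : (1 : ℝ) ≤ N := by exact_mod_cast hN
  have hN0 : (0 : ℝ) < N := by linarith
  obtain ⟨a₀, ha₀⟩ : A.Nonempty := Finset.card_pos.1 (by omega)
  obtain ⟨b₀, hb₀⟩ : B.Nonempty := Finset.card_pos.1 (by omega)
  have hne : ∀ a ∈ A ×ˢ B, a.1 ≠ a.2 := fun a ha h =>
    Finset.disjoint_left.1 hAB (Finset.mem_product.1 ha).1 (h ▸ (Finset.mem_product.1 ha).2)
  have hst : t / N ≤ t := div_le_self ht0.le hN1
  set S : Finset (Label d) := (A ∪ B).image fun z => (z, 0)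
  have hcard : (S.card : ℝ) ≤ 2 * N := by
    have h1 : S.card ≤ (A ∪ B).card := Finset.card_image_le
    have h2 := Finset.card_union_le A B
    have : S.card ≤ 2 * N := by omega
    exact_mod_cast this
  have hS : ∀ a ∈ A ×ˢ B, endpoints a ⊆ S := fun a ha l hl => by
    obtain ⟨h1, h2⟩ := Finset.mem_product.1 ha
    rw [endpoints, Finset.mem_insert, Finset.mem_singleton] at hl
    rcases hl with rfl | rfl
    · exact Finset.mem_image_of_mem _ (Finset.mem_union_left _ h1)
    · exact Finset.mem_image_of_mem _ (Finset.mem_union_right _ h2)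
  have hcube : ∀ z : Cell d, WithLp.toLp 2 (fun i => (z i : ℝ) + 1) ∈ cube z := fun z i => by simp
  -- Here the two small marks identify the edge, and its own variable need only be at most the
  -- constant `ρ r`.
  have key := le_oneEdgeCrossProb (γ := 1 / 2) (ρ := ρ) (s := t / N) (q := ρ r) (R := R) lam hAB
    (S₁ := fun _ => S) (S₂ := fun a => {link a}) hS (fun a _ => Finset.mem_singleton_self _)
    (fun z hz x hx => (hgeo z hz b₀ hb₀ x hx _ (hcube b₀)).1)
    (fun w hw y hy => (hgeo a₀ ha₀ w hw _ (hcube a₀) y hy).2.1)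
    (fun z hz w hw x hx y hy u hu v hv => by
      have hD := (hgeo z hz w hw x hx y hy).2.2
      have hu0 := hu.1.le
      have hv0 := hv.1.le
      have huv : (u * v) ^ (1 / 2 : ℝ) ≤ t / N := by
        rw [← Real.sqrt_eq_rpow]
        refine Real.sqrt_le_iff.2 ⟨by positivity, ?_⟩
        rw [sq]
        exact mul_le_mul hu.2 hv.2 hv0 (by positivity)
      have huv0 : 0 ≤ (u * v) ^ (1 / 2 : ℝ) := Real.rpow_nonneg (mul_nonneg hu0 hv0) _
      refine hρ.antitone (Set.mem_Ici.2 (by positivity)) hr.le ?_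
      calc ‖y - x‖ ^ d * (u * v) ^ (1 / 2 : ℝ) ≤ L * N * (t / N) :=
            mul_le_mul hD huv huv0 (by positivity)
        _ = t * L := by field_simp
        _ ≤ r := (le_div_iff₀ hL0).1 htr)
    (fun a ha b hb hab => Or.inl (disjoint_lowSet (hS a ha) (fun h => hab ?_) _))
    (p₁ := (t / N) ^ 2 * (1 / 2)) (p₂ := ρ r) hρr.le
    (fun a ha => by
      refine le_trans (le_of_eq ?_) (le_infinitePi_unif_real_lowSet (hS a ha) (by positivity)
        (by linarith) ?_)
      · rw [card_endpoints (hne a ha)]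
      · refine (mul_le_mul_of_nonneg_right hcard (by positivity)).trans ?_
        rw [mul_assoc, mul_div_cancel₀ _ hN0.ne']; linarith)
    (fun a _ => by
      rw [infinitePi_unif_real_lowSet_self _ hρr.le (hρ.mem_Icc r hr.le).2,
        Finset.card_singleton, pow_one])
  · refine le_trans (le_of_eq ?_) key
    rw [hA, hB]
    field_simp
    rfl
  · obtain ⟨ha1, ha2⟩ := Finset.mem_product.1 ha
    obtain ⟨hb1, hb2⟩ := Finset.mem_product.1 hb
    simp only [endpoints, Finset.insert_subset_iff, Finset.singleton_subset_iff,
      Finset.mem_insert, Finset.mem_singleton, Prod.mk.injEq, and_true] at h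
    refine Prod.ext (h.1.resolve_right fun h' => ?_) (h.2.resolve_left fun h' => ?_)
    · exact Finset.disjoint_left.1 hAB ha1 (h' ▸ hb2)
    · exact Finset.disjoint_left.1 hAB hb1 (h' ▸ ha2)

theorem HasDecayExponent.exists_pos {ρ : ℝ → ℝ} {δ : ℝ≥0∞} (h : HasDecayExponent ρ δ) :
    ∃ r : ℝ, 0 < r ∧ 0 < ρ r := by
  rcases h with ⟨-, r, hr, h⟩ | ⟨-, c, C, hc, -, h⟩
  · exact ⟨r, hr, by rw [h r hr.le, if_pos le_rfl]; exact one_pos⟩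
  · refine ⟨1, one_pos, hc.trans_le ?_⟩
    simpa using (h 1 le_rfl).1

theorem oneEdgeCrossProb_le_crossProb (d : ℕ) (γ : ℝ) (ρ : ℝ → ℝ) (lam : ℝ≥0) (R : ℝ) :
    oneEdgeCrossProb d γ ρ lam R ≤ crossProb d γ ρ lam R :=
  measureReal_mono fun _ ⟨a, b, ha, hb, hA, hB, p, hp, _⟩ => ⟨a, b, ha, hb, hA, hB, p, hp⟩

theorem asympEq_one_of_le {f : ℝ → ℝ} (hf : ∀ R, f R ≤ 1) {c R₀ : ℝ} (hc : 0 < c) (hR₀ : 1 < R₀)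
    (h : ∀ R, R₀ ≤ R → c ≤ f R) : AsympEq f fun _ => 1 := by
  refine ⟨⟨2, 2, one_lt_two, one_lt_two, fun R _ => by linarith [hf R]⟩,
    ⟨c⁻¹ + 1, R₀, by linarith [inv_pos.2 hc], hR₀, fun R hR => ?_⟩⟩
  have h1 := h R hR
  have h2 : (c⁻¹ + 1) * c ≤ (c⁻¹ + 1) * f R :=
    mul_le_mul_of_nonneg_left h1 (by positivity)
  rw [add_mul, inv_mul_cancel₀ hc.ne'] at h2
  linarith

end GIRG

theorem mainTheorem7 (d : ℕ) (hd : 1 ≤ d) (γ : ℝ) (hγ0 : 0 ≤ γ) (hγ1 : γ < 1)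
    (δ : ℝ≥0∞) (hδ : 1 < δ) (ρ : ℝ → ℝ) (hρ : GIRG.IsProfile d ρ)
    (hρδ : GIRG.HasDecayExponent ρ δ) (hcrit : δ = 2 ∨ γ = 1 / 2) :
    (∀ lam : ℝ≥0, 0 < lam →
      GIRG.AsympEq (GIRG.oneEdgeCrossProb d γ ρ lam) (fun _ => 1)) ∧
    GIRG.criticalIntensity d γ ρ = 0 := by
  have key : ∀ lam : ℝ≥0, 0 < lam → ∃ c R₀ : ℝ, 0 < c ∧ 1 < R₀ ∧
      ∀ R, R₀ ≤ R → c ≤ GIRG.oneEdgeCrossProb d γ ρ lam R := by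
    intro lam hlam
    rcases hcrit with rfl | rfl
    · refine GIRG.exists_pos_le_oneEdgeCrossProb_of_exponent_two hd hγ0 hρ ?_ hlam
      rcases hρδ with h | h
      · exact absurd h.1 (by simp)
      · simpa using h.2
    · obtain ⟨r, hr, hρr⟩ := hρδ.exists_pos
      exact GIRG.exists_pos_le_oneEdgeCrossProb_of_gamma_half hd hρ hr hρr hlam
  refine ⟨fun lam hlam => ?_, ?_⟩
  · obtain ⟨c, R₀, hc, hR₀, h⟩ := key lam hlam
    exact GIRG.asympEq_one_of_le (fun R => measureReal_le_one) hc hR₀ h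
  · rw [GIRG.criticalIntensity]
    refine iSup₂_eq_bot.2 fun lam hlim => ?_
    rcases eq_zero_or_pos lam with rfl | hlam
    · simp
    · obtain ⟨c, R₀, hc, -, h⟩ := key lam hlam
      refine absurd (ge_of_tendsto hlim ?_) (not_le.2 hc)
      filter_upwards [eventually_ge_atTop R₀] with R hR
      exact (h R hR).trans (GIRG.oneEdgeCrossProb_le_crossProb d γ ρ lam R)
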